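/- Let $\mathbb K$ be a field, $\Gamma$ a divisible totally ordered abelian group, $\Gamma_\infty=\Gamma\cup\{\infty\}$, and $\nu_0:\mathbb K\to\Gamma_\infty$ a valuation. A valuation on a commutative ring is a map $\nu$ to $\Gamma_\infty$ with $\nu(ab)=\nu(a)+\nu(b)$, $\nu(a+b)\ge\min\{\nu(a),\nu(b)\}$, $\nu(1)=0$, $\nu(0)=\infty$ (nonzero elements may have value $\infty$). Let $$\mathcal V=\{\nu_0\}\cup\{\nu:\mathbb K[x]\to\Gamma_\infty\mid\nu\text{ is a valuation with }\nu|_{\mathbb K}=\nu_0\},$$ partially ordered by $\nu_0\le\nu$ for all $\nu\in\mathcal V$, and, for $\nu,\mu\neq\nu_0$, $\nu\le\mu$ if and only if $\nu(f)\le\mu(f)$ for all $f\in\mathbb K[x]$. Let $\mathfrak v=\{\nu_i\}_{i\in I}\subset\mathcal V$ be a nonempty totally ordered subset without maximal element, and order $I$ accordingly. A polynomial $f\in\mathbb K[x]$ is $\mathfrak v$-stable if there is $i_f\in I$ with $\nu_{i_f}\neq\nu_0$ such that $\nu_i(f)=\nu_{i_f}(f)$ for all $i\ge i_f$; then put $\mathfrak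 v(f)=\nu_{i_f}(f)$. Assume that some polynomial is not $\mathfrak v$-stable, let $Q$ be a monic polynomial of smallest degree that is not $\mathfrak v$-stable, and let $\gamma\in\Gamma_\infty$ satisfy $\gamma>\nu_i(Q)$ for all $i\in I$ with $\nu_i\ne\nu_0$. For a non-constant $q\in\mathbb K[x]$, the $q$-expansion of $f\in\mathbb K[x]$ is the unique expression $f=f_0+f_1q+\cdots+f_sq^s$ with $\deg f_j<\deg q$ for all $j$; for a valuation $\nu$ on $\mathbb K[x]$ the truncation of $\nu$ at $q$ is $\nu_q(f)=\min_{0\le j\le s}\nu(f_jq^j)$. For a valuation $\nu$ on $\mathbb K[x]$ with values in $\Gamma_\infty$, let $\overline\nu$ be an extension of $\nu$ to $\overline{\mathbb K}[x]$ with values in $\Gamma_\infty$, where $\overline{\mathbb K}$ is an algebraic closure of $\mathbb K$. For $f\in\mathbb K[x]$ put $\delta(f)=\max\{\overline\nu(x-a)\mid a\in\overline{\mathbb K},\ f(a)=0\}$ if $f$ is non-constant and $\delta(f)=-\infty$ if $f$ is a nonzero constant. A monic polynomial $P\in\mathbb K[x]$ is a key polynomial for $\nu$ if, for every choice of $\overline\nu$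 and every nonzero $f\in\mathbb K[x]$, $\delta(f)\ge\delta(P)$ implies $\deg f\ge\deg P$. Then the following hold. 1. The map $\mu:\mathbb K[x]\to\Gamma_\infty$ given by $$\mu(f)=\min_{0\le j\le r}\{\mathfrak v(f_j)+j\gamma\},$$ where $f=f_0+f_1Q+\cdots+f_rQ^r$ is the $Q$-expansion of $f$, is a valuation with $\mu|_{\mathbb K}=\nu_0$. 2. $\nu_i<\mu$ in $\mathcal V$ for every $i\in I$. 3. $\mu=\mu_Q$, and $Q$ is a key polynomial for $\mu$. -/

import Mathlib

open Polynomial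

noncomputable section

namespace KeyPoly

variable {K : Type*} [Field K]
variable {Γ : Type*} [AddCommGroup Γ] [LinearOrder Γ] [IsOrderedAddMonoid Γ]

/-! ### `q`-expansions -/

/-- The `j`-th coefficient of the `q`-expansion `f = f₀ + f₁ q + ⋯ + f_s q ^ s`, `deg f_j < deg q`,
of `f`, for a non-constant polynomial `q`, computed by repeated division by `q`. That this is the
expansion, and that the expansion is unique, is said by `degree_expansionCoeff_lt`,
`sum_expansionCoeff` and `expansionCoeff_of_eq_sum`. -/
def expansionCoeff (q : K[X]) : K[X] → ℕ → K[X]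
  | f, 0 => f % q
  | f, j + 1 => expansionCoeff q (f / q) j

theorem degree_expansionCoeff_lt {q : K[X]} (hq : 0 < q.natDegree) (f : K[X]) (j : ℕ) :
    (expansionCoeff q f j).degree < q.degree := by
  have h0 : q ≠ 0 := by rintro rfl; simp at hq
  induction j generalizing f with
  | zero => exact EuclideanDomain.mod_lt _ h0
  | succ j ih => exact ih _

theorem sum_expansionCoeff {q : K[X]} (hq : 0 < q.natDegree) (f : K[X]) {n : ℕ}
    (hn : f.natDegree < n) : f = ∑ j ∈ Finset.range n, expansionCoeff q f j * q ^ j := by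
  induction n generalizing f with
  | zero => omega
  | succ n ih =>
    rw [Finset.sum_range_succ']
    simp only [expansionCoeff, pow_zero, mul_one]
    have key : f / q = ∑ j ∈ Finset.range n, expansionCoeff q (f / q) j * q ^ j := by
      rcases Nat.eq_zero_or_pos n with rfl | hpos
      · rw [Finset.range_zero, Finset.sum_empty, Polynomial.div_eq_zero_iff
          (by rintro rfl; simp at hq)]
        exact Polynomial.degree_lt_degree (by omega)
      · refine ih _ ?_
        rcases eq_or_ne f 0 with rfl | hf
        · simpa using hpos
        · rcases eq_or_ne (f / q) 0 with hd | hd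
          · simpa [hd] using hpos
          · have := Polynomial.natDegree_lt_natDegree hd
              (Polynomial.degree_div_lt hf (Polynomial.natDegree_pos_iff_degree_pos.1 hq))
            omega
    calc f = f / q * q + f % q := by rw [mul_comm]; exact (EuclideanDomain.div_add_mod f q).symm
      _ = _ := by
        conv_lhs => rw [key]
        rw [Finset.sum_mul]
        simp only [pow_succ, mul_assoc]

theorem expansionCoeff_of_eq_sum {q : K[X]} (hq : 0 < q.natDegree) (f : K[X]) (n : ℕ)
    (c : ℕ → K[X]) (hc : ∀ j, (c j).degree < q.degree)
    (hf : f = ∑ j ∈ Finset.range n, c j * q ^ j) {j : ℕ} (hj : j < n) :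
    expansionCoeff q f j = c j := by
  have h0 : q ≠ 0 := by rintro rfl; simp at hq
  induction n generalizing f c j with
  | zero => omega
  | succ n ih =>
    have h1 : f = c 0 + q * ∑ j ∈ Finset.range n, c (j + 1) * q ^ j := by
      rw [hf, Finset.sum_range_succ', Finset.mul_sum, add_comm]
      simp only [pow_succ, pow_zero, mul_one]
      congr 1
      exact Finset.sum_congr rfl fun _ _ => by ring
    have hmod : f % q = c 0 := by
      rw [Polynomial.mod_eq_of_dvd_sub (p₂ := c 0) (by rw [h1]; simp)]
      exact (Polynomial.mod_eq_self_iff h0).2 (hc 0)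
    cases j with
    | zero => exact hmod
    | succ j =>
      refine ih (f / q) (fun j => c (j + 1)) (fun j => hc _) ?_ (by omega)
      have h2 := EuclideanDomain.div_add_mod f q
      rw [hmod] at h2
      apply mul_left_cancel₀ h0
      linear_combination h2 + h1

/-! ### Truncations -/

/-- The truncation `ν_q(f) = min_j ν(f_j q ^ j)`, where the `f_j` are the coefficients of the
`q`-expansion of `f` (they vanish for `j > deg f`, and zero terms contribute `∞`). -/
def truncation (ν : AddValuation K[X] (WithTop Γ)) (q f : K[X]) : WithTop Γ :=
  (Finset.range (f.natDegree + 1)).inf fun j => ν (expansionCoeff q f j * q ^ j)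

/-! ### Key polynomials -/

/-- `δ(f) = max {w(x - a) : f(a) = 0}` for a non-zero polynomial `f` over an algebraically closed
field with a valuation `w` on polynomials; it is `-∞` if `f` is a non-zero constant. -/
def delta {L : Type*} [Field L] (w : AddValuation L[X] (WithTop Γ)) (f : L[X]) :
    WithBot (WithTop Γ) :=
  (f.roots.map fun a => ((w (X - C a) : WithTop Γ) : WithBot (WithTop Γ))).sup

/-- `w`, a valuation on `K̄[x]`, extends the valuation `ν` on `K[x]`. -/
def Extends (ν : AddValuation K[X] (WithTop Γ))
    (w : AddValuation (AlgebraicClosure K)[X] (WithTop Γ)) : Prop :=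
  ∀ f : K[X], w (f.map (algebraMap K (AlgebraicClosure K))) = ν f

/-- `Q` is a key polynomial for `ν`: it is monic and, for an extension `w` of `ν` to `K̄[x]`, every
non-zero `f ∈ K[x]` with `δ(f) ≥ δ(Q)` has `deg f ≥ deg Q`. Here `δ` is taken with respect to `w`;
its values on `K[x]` do not depend on the choice of `w`, and the condition is imposed for every
choice. When `Γ` is divisible, an extension of `ν` with values in `Γ ∪ {∞}` exists, and all
extensions with values in ordered groups containing `Γ` have values in `Γ ∪ {∞}`. -/
def IsKeyPolynomial (ν : AddValuation K[X] (WithTop Γ)) (Q : K[X]) : Prop :=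
  Q.Monic ∧
    ∀ w : AddValuation (AlgebraicClosure K)[X] (WithTop Γ), Extends ν w →
      ∀ f : K[X], f ≠ 0 →
        delta w (Q.map (algebraMap K (AlgebraicClosure K))) ≤
          delta w (f.map (algebraMap K (AlgebraicClosure K))) →
        Q.degree ≤ f.degree

/-! ### The partially ordered set of extensions of `ν₀` -/

/-- A valuation on `K[x]` with values in `Γ ∪ {∞}` that extends the valuation `ν₀` on `K`. -/
@[ext]
structure PolyVal (ν₀ : AddValuation K (WithTop Γ)) where
  /-- the underlying valuation on `K[x]` -/
  val : AddValuation K[X] (WithTop Γ)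
  /-- its restriction to `K` is `ν₀` -/
  val_C : ∀ a : K, val (C a) = ν₀ a

/-- `ν ≤ μ` if and only if `ν(f) ≤ μ(f)` for every `f`. -/
instance (ν₀ : AddValuation K (WithTop Γ)) : PartialOrder (PolyVal ν₀) :=
  PartialOrder.lift (fun ν (f : K[X]) => ν.val f) fun _ _ h =>
    PolyVal.ext (AddValuation.ext fun f => congrFun h f)

/-- `𝒱 = {ν₀} ∪ {ν : ν a valuation on K[x] extending ν₀}`: the bottom element `⊥` is `ν₀`, which lies
below all the valuations on `K[x]`. -/
abbrev ValPoset (ν₀ : AddValuation K (WithTop Γ)) : Type _ :=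
  WithBot (PolyVal ν₀)

variable {ν₀ : AddValuation K (WithTop Γ)}

/-! ### Stability and the map `μ` -/

/-- `ν` is an index from which on the values of the family `v` at `f` are constant. -/
def IsStableFrom (v : Set (ValPoset ν₀)) (f : K[X]) (ν : PolyVal ν₀) : Prop :=
  (ν : ValPoset ν₀) ∈ v ∧
    ∀ ν' : PolyVal ν₀, (ν' : ValPoset ν₀) ∈ v → ν ≤ ν' → ν'.val f = ν.val f

/-- `f` is `v`-stable. -/
def IsStable (v : Set (ValPoset ν₀)) (f : K[X]) : Prop :=
  ∃ ν : PolyVal ν₀, IsStableFrom v f ν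

open Classical in
/-- The stable value `v(f) = ν_{i_f}(f)` of a `v`-stable polynomial `f` (and `∞`, a default value,
if `f` is not `v`-stable). -/
def stableValue (v : Set (ValPoset ν₀)) (f : K[X]) : WithTop Γ :=
  if h : IsStable v f then h.choose.val f else ⊤

/-- The stable value does not depend on the index. -/
theorem stableValue_eq {v : Set (ValPoset ν₀)} (hv : IsChain (· ≤ ·) v) {f : K[X]} {ν : PolyVal ν₀}
    (h : IsStableFrom v f ν) : stableValue v f = ν.val f := by
  have hs : IsStable v f := ⟨ν, h⟩
  rw [stableValue, dif_pos hs]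
  have h' := hs.choose_spec
  rcases hv.total h.1 h'.1 with hle | hle
  · exact h.2 _ h'.1 (WithBot.coe_le_coe.1 hle)
  · exact (h'.2 _ h.1 (WithBot.coe_le_coe.1 hle)).symm

/-- The map `f₀ + f₁ Q + ⋯ + f_r Q ^ r ↦ min_j (v(f_j) + j γ)` on `Q`-expansions. -/
def limitMap (v : Set (ValPoset ν₀)) (Q : K[X]) (γ : WithTop Γ) (f : K[X]) : WithTop Γ :=
  (Finset.range (f.natDegree + 1)).inf fun j => stableValue v (expansionCoeff Q f j) + j • γ

end KeyPoly

end


/-! The map `μ` is a limit augmentation in the sense of MacLane and Vaquié. On the polynomials of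
degree less than `deg Q`, seen as representatives of `K[x] / (Q)`, the stable values form a
valuation: if the values of `Q s + r` and of `r` became constant but distinct, the values of `Q s`,
hence those of `Q`, would become constant too, so the product of two representatives has the same
stable value as its remainder modulo `Q`. Assigning to `Q` a value `γ` above all `ν_i(Q)` then gives
a valuation `μ`. An equality `ν_i(Q s) = ν_i(r)` with finite values is destroyed by passing to
larger `i`, because `ν_i(Q)` keeps growing; hence `ν_i(Q s + r) = min {ν_i(Q s), ν_i(r)}` for large
`i`, and `ν_i ≤ μ` by induction along the `Q`-expansion.

For `0 < deg f < deg Q` the remainder of `Q` modulo `f` satisfies `μ(Q % f) < μ(Q)`, since otherwise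
`ν_i(Q) = ν_i(f (Q / f))` would be constant for large `i`. This inequality makes `Q` a key
polynomial, by descent on the degree of a counterexample `f`. -/

open Polynomial Filter

noncomputable section

namespace KeyPoly

universe u

variable {K : Type*} [Field K]
variable {Γ : Type u} [AddCommGroup Γ] [LinearOrder Γ]

section Expansion

variable {q : K[X]}

theorem add_div (f g q : K[X]) : (f + g) / q = f / q + g / q := by
  rcases eq_or_ne q 0 with rfl | hq
  · simp only [EuclideanDomain.div_zero, add_zero]
  · apply mul_left_cancel₀ hq
    linear_combination EuclideanDomain.div_add_mod (f + g) q - EuclideanDomain.div_add_mod f q -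
      EuclideanDomain.div_add_mod g q - add_mod f g q

theorem mul_add_div_of_degree_lt (f : K[X]) {r : K[X]} (hr : r.degree < q.degree) :
    (q * f + r) / q = f := by
  rw [add_div, mul_div_cancel_left₀ f (ne_zero_of_degree_gt hr),
    (Polynomial.div_eq_zero_iff (ne_zero_of_degree_gt hr)).2 hr, add_zero]

theorem mul_add_mod_of_degree_lt (f : K[X]) {r : K[X]} (hr : r.degree < q.degree) :
    (q * f + r) % q = r := by
  rw [add_mod, EuclideanDomain.mod_eq_zero.2 (dvd_mul_right q f), zero_add,
    (mod_eq_self_iff (ne_zero_of_degree_gt hr)).2 hr]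

theorem degree_zero_lt_degree (hq : q ≠ 0) : (0 : K[X]).degree < q.degree :=
  degree_zero.trans_lt (bot_lt_iff_ne_bot.2 (degree_ne_bot.2 hq))

theorem degree_C_lt_degree (hq : 0 < q.natDegree) (a : K) : (C a).degree < q.degree :=
  degree_C_le.trans_lt (natDegree_pos_iff_degree_pos.1 hq)

theorem degree_mul_div_lt {f g : K[X]} (hf : f.degree < q.degree) (hg : g.degree < q.degree) :
    (f * g / q).degree < q.degree := by
  have hq : q ≠ 0 := ne_zero_of_degree_gt hf
  rcases lt_or_ge (f * g).degree q.degree with hlt | hle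
  · rw [(Polynomial.div_eq_zero_iff hq).2 hlt]
    exact degree_zero_lt_degree hq
  · have hsum : q.degree + (f * g / q).degree < q.degree + q.degree := by
      calc q.degree + (f * g / q).degree = f.degree + g.degree := by
            rw [degree_add_div hq hle, degree_mul]
        _ ≤ f.degree + q.degree := add_le_add_right hg.le _
        _ < q.degree + q.degree := WithBot.add_lt_add_right (degree_ne_bot.2 hq) hf
    exact lt_of_add_lt_add_left hsum

theorem expansion_induction (hq : 0 < q.natDegree) {P : K[X] → Prop} (zero : P 0)
    (mul_add : ∀ f r : K[X], r.degree < q.degree → P f → P (q * f + r)) (f : K[X]) : P f := by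
  have hq' : 0 < q.degree := natDegree_pos_iff_degree_pos.1 hq
  induction f using WellFounded.induction degree_lt_wf with
  | _ f ih =>
    rcases eq_or_ne f 0 with rfl | hf
    · exact zero
    · rw [← EuclideanDomain.div_add_mod f q]
      exact mul_add _ _ (degree_mod_lt f (ne_zero_of_degree_gt hq')) (ih _ (degree_div_lt hf hq'))

theorem expansionCoeff_of_zero (q : K[X]) (j : ℕ) : expansionCoeff q 0 j = 0 := by
  induction j with
  | zero => exact EuclideanDomain.zero_mod q
  | succ j ih => rwa [expansionCoeff, EuclideanDomain.zero_div]

theorem expansionCoeff_add (q f g : K[X]) (j : ℕ) :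
    expansionCoeff q (f + g) j = expansionCoeff q f j + expansionCoeff q g j := by
  induction j generalizing f g with
  | zero => exact add_mod f g q
  | succ j ih => simp only [expansionCoeff, add_div, ih]

theorem expansionCoeff_neg (q f : K[X]) (j : ℕ) :
    expansionCoeff q (-f) j = -expansionCoeff q f j := by
  rw [eq_neg_iff_add_eq_zero, ← expansionCoeff_add, neg_add_cancel, expansionCoeff_of_zero]

theorem expansionCoeff_eq_zero_of_natDegree_lt (hq : 0 < q.natDegree) {f : K[X]} {j : ℕ}
    (hj : f.natDegree < j) : expansionCoeff q f j = 0 := by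
  induction j generalizing f with
  | zero => exact absurd hj (Nat.not_lt_zero _)
  | succ j ih =>
    rw [expansionCoeff]
    rcases eq_or_ne (f / q) 0 with h0 | h0
    · rw [h0, expansionCoeff_of_zero]
    · have hf : f ≠ 0 := by rintro rfl; exact h0 EuclideanDomain.zero_div
      have := natDegree_lt_natDegree h0 (degree_div_lt hf (natDegree_pos_iff_degree_pos.1 hq))
      exact ih (by omega)

end Expansion

section Augmentation

/-- The map `f₀ + f₁ q + ⋯ + f_r q ^ r ↦ min_j (V(f_j) + j γ)` on `q`-expansions. It only depends
on the values of `V` at the polynomials of degree less than `deg q`. -/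
def expansionMin (V : K[X] → WithTop Γ) (q : K[X]) (γ : WithTop Γ) (f : K[X]) : WithTop Γ :=
  (Finset.range (f.natDegree + 1)).inf fun j => V (expansionCoeff q f j) + j • γ

/-- The conditions on `V`, `q` and `γ` under which `expansionMin V q γ` is a valuation: on the
polynomials of degree less than `deg q`, seen as representatives of `K[x] / (q)`, the map `V` is a
valuation, and the quotients that occur in products of representatives are not too small. -/
structure IsAugmentationDatum (V : K[X] → WithTop Γ) (q : K[X]) (γ : WithTop Γ) : Prop where
  natDegree_pos : 0 < q.natDegree
  map_zero : V 0 = ⊤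
  map_one : V 1 = 0
  map_neg : ∀ f, f.degree < q.degree → V (-f) = V f
  map_add : ∀ f g, f.degree < q.degree → g.degree < q.degree → min (V f) (V g) ≤ V (f + g)
  map_mul_mod : ∀ f g, f.degree < q.degree → g.degree < q.degree → V (f * g % q) = V f + V g
  le_map_mul_div : ∀ f g, f.degree < q.degree → g.degree < q.degree →
    V f + V g ≤ V (f * g / q) + γ

namespace IsAugmentationDatum

variable {V : K[X] → WithTop Γ} {q : K[X]} {γ : WithTop Γ}

theorem ne_zero (h : IsAugmentationDatum V q γ) : q ≠ 0 :=
  ne_zero_of_natDegree_gt h.natDegree_pos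

theorem degree_one_lt (h : IsAugmentationDatum V q γ) : (1 : K[X]).degree < q.degree :=
  C_1 (R := K) ▸ degree_C_lt_degree h.natDegree_pos 1

variable [IsOrderedAddMonoid Γ]

theorem le_expansionMin_iff (h : IsAugmentationDatum V q γ) {f : K[X]} {m : WithTop Γ} :
    m ≤ expansionMin V q γ f ↔ ∀ j, m ≤ V (expansionCoeff q f j) + j • γ := by
  rw [expansionMin, Finset.le_inf_iff]
  refine ⟨fun hm j => ?_, fun hm j _ => hm j⟩
  rcases lt_or_ge j (f.natDegree + 1) with hj | hj
  · exact hm j (Finset.mem_range.2 hj)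
  · rw [expansionCoeff_eq_zero_of_natDegree_lt h.natDegree_pos hj, h.map_zero, top_add]
    exact le_top

theorem expansionMin_zero (h : IsAugmentationDatum V q γ) : expansionMin V q γ 0 = ⊤ :=
  top_unique <| h.le_expansionMin_iff.2 fun j => by
    rw [expansionCoeff_of_zero, h.map_zero, top_add]

theorem expansionMin_mul_add (h : IsAugmentationDatum V q γ) (f : K[X]) {r : K[X]}
    (hr : r.degree < q.degree) :
    expansionMin V q γ (q * f + r) = min (expansionMin V q γ f + γ) (V r) := by
  have hcoeff_zero : expansionCoeff q (q * f + r) 0 = r := mul_add_mod_of_degree_lt f hr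
  have hcoeff_succ (j : ℕ) : expansionCoeff q (q * f + r) (j + 1) = expansionCoeff q f j := by
    rw [expansionCoeff, mul_add_div_of_degree_lt f hr]
  refine eq_of_forall_le_iff fun m => ?_
  rw [h.le_expansionMin_iff, le_min_iff]
  constructor
  · refine fun hm => ⟨?_, by simpa only [hcoeff_zero, zero_nsmul, add_zero] using hm 0⟩
    obtain ⟨j, -, hj⟩ := Finset.exists_mem_eq_inf (Finset.range (f.natDegree + 1))
      Finset.nonempty_range_add_one fun j => V (expansionCoeff q f j) + j • γ
    rw [expansionMin, hj, add_assoc, ← succ_nsmul, ← hcoeff_succ]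
    exact hm (j + 1)
  · rintro ⟨hf, hr⟩ (_ | j)
    · simpa only [hcoeff_zero, zero_nsmul, add_zero] using hr
    · rw [hcoeff_succ, succ_nsmul, ← add_assoc]
      exact hf.trans (add_le_add_left (h.le_expansionMin_iff.1 le_rfl j) γ)

theorem expansionMin_of_degree_lt (h : IsAugmentationDatum V q γ) {r : K[X]}
    (hr : r.degree < q.degree) : expansionMin V q γ r = V r := by
  simpa only [mul_zero, zero_add, h.expansionMin_zero, top_add, min_top_left] using
    h.expansionMin_mul_add 0 hr

theorem expansionMin_self_mul (h : IsAugmentationDatum V q γ) (f : K[X]) :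
    expansionMin V q γ (q * f) = expansionMin V q γ f + γ := by
  simpa only [add_zero, h.map_zero, min_top_right] using
    h.expansionMin_mul_add f (degree_zero_lt_degree h.ne_zero)

theorem expansionMin_neg (h : IsAugmentationDatum V q γ) (f : K[X]) :
    expansionMin V q γ (-f) = expansionMin V q γ f := by
  refine eq_of_forall_le_iff fun m => ?_
  simp only [h.le_expansionMin_iff, expansionCoeff_neg,
    h.map_neg _ (degree_expansionCoeff_lt h.natDegree_pos f _)]

theorem min_le_expansionMin_add (h : IsAugmentationDatum V q γ) (f g : K[X]) :
    min (expansionMin V q γ f) (expansionMin V q γ g) ≤ expansionMin V q γ (f + g) := by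
  refine h.le_expansionMin_iff.2 fun j => ?_
  have hcoeff_lt (p : K[X]) := degree_expansionCoeff_lt h.natDegree_pos p j
  calc min (expansionMin V q γ f) (expansionMin V q γ g)
      ≤ min (V (expansionCoeff q f j) + j • γ) (V (expansionCoeff q g j) + j • γ) :=
        min_le_min (h.le_expansionMin_iff.1 le_rfl j) (h.le_expansionMin_iff.1 le_rfl j)
    _ = min (V (expansionCoeff q f j)) (V (expansionCoeff q g j)) + j • γ :=
        min_add_add_right _ _ _
    _ ≤ V (expansionCoeff q (f + g) j) + j • γ := by
        rw [expansionCoeff_add]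
        exact add_le_add_left (h.map_add _ _ (hcoeff_lt f) (hcoeff_lt g)) _

theorem expansionMin_add_eq_of_lt (h : IsAugmentationDatum V q γ) {f g : K[X]}
    (hfg : expansionMin V q γ f < expansionMin V q γ g) :
    expansionMin V q γ (f + g) = expansionMin V q γ f := by
  refine le_antisymm (le_of_not_gt fun hlt => ?_) ?_
  · have hmin := h.min_le_expansionMin_add (f + g) (-g)
    rw [h.expansionMin_neg, add_neg_cancel_right] at hmin
    exact (lt_min hlt hfg).not_ge hmin
  · simpa only [min_eq_left hfg.le] using h.min_le_expansionMin_add f g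

theorem add_le_expansionMin_mul_mul_add (h : IsAugmentationDatum V q γ) {f g r : K[X]}
    (hr : r.degree < q.degree)
    (hg : expansionMin V q γ f + expansionMin V q γ g ≤ expansionMin V q γ (f * g))
    (hfr : expansionMin V q γ f + V r ≤ expansionMin V q γ (f * r)) :
    expansionMin V q γ f + expansionMin V q γ (q * g + r) ≤
      expansionMin V q γ (f * (q * g + r)) := by
  rw [h.expansionMin_mul_add g hr, ← min_add_add_left, ← add_assoc, mul_add, mul_left_comm]
  refine (min_le_min ?_ hfr).trans (h.min_le_expansionMin_add _ _)
  rw [h.expansionMin_self_mul]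
  exact add_le_add_left hg γ

theorem add_le_expansionMin_mul_of_degree_lt (h : IsAugmentationDatum V q γ) {r : K[X]}
    (hr : r.degree < q.degree) (f : K[X]) :
    V r + expansionMin V q γ f ≤ expansionMin V q γ (r * f) := by
  rw [← h.expansionMin_of_degree_lt hr]
  induction f using expansion_induction h.natDegree_pos with
  | zero => simp only [mul_zero, h.expansionMin_zero, le_top]
  | mul_add f s hs ih =>
    refine h.add_le_expansionMin_mul_mul_add hs ih ?_
    rw [h.expansionMin_of_degree_lt hr, ← EuclideanDomain.div_add_mod (r * s) q,
      h.expansionMin_mul_add _ (degree_mod_lt _ h.ne_zero),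
      h.expansionMin_of_degree_lt (degree_mul_div_lt hr hs)]
    exact le_min (h.le_map_mul_div r s hr hs) (h.map_mul_mod r s hr hs).ge

theorem add_le_expansionMin_mul (h : IsAugmentationDatum V q γ) (f g : K[X]) :
    expansionMin V q γ f + expansionMin V q γ g ≤ expansionMin V q γ (f * g) := by
  induction g using expansion_induction h.natDegree_pos with
  | zero => simp only [mul_zero, h.expansionMin_zero, le_top]
  | mul_add g r hr ih =>
    refine h.add_le_expansionMin_mul_mul_add hr ih ?_
    rw [add_comm, mul_comm]
    exact h.add_le_expansionMin_mul_of_degree_lt hr f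

theorem expansionMin_mul_mul_add_of_lt (h : IsAugmentationDatum V q γ) {f g r : K[X]}
    (hr : r.degree < q.degree)
    (hg : expansionMin V q γ (f * g) = expansionMin V q γ f + expansionMin V q γ g)
    (hlt : expansionMin V q γ g + γ < V r) :
    expansionMin V q γ (f * (q * g + r)) =
      expansionMin V q γ f + expansionMin V q γ (q * g + r) := by
  have hmain : expansionMin V q γ (q * (f * g)) = expansionMin V q γ f +
      (expansionMin V q γ g + γ) := by
    rw [h.expansionMin_self_mul, hg, add_assoc]
  rcases eq_or_ne (expansionMin V q γ f) ⊤ with hf | hf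
  · rw [hf, top_add, ← top_le_iff]
    simpa only [hf, top_add] using h.add_le_expansionMin_mul f (q * g + r)
  rw [h.expansionMin_mul_add g hr, min_eq_left hlt.le, mul_add, mul_left_comm, ← hmain]
  refine h.expansionMin_add_eq_of_lt ?_
  calc expansionMin V q γ (q * (f * g))
      = expansionMin V q γ f + (expansionMin V q γ g + γ) := hmain
    _ < expansionMin V q γ f + expansionMin V q γ r := by
        rw [h.expansionMin_of_degree_lt hr]
        exact WithTop.add_lt_add_left hf hlt
    _ ≤ expansionMin V q γ (f * r) := h.add_le_expansionMin_mul f r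

theorem expansionMin_le_mod (h : IsAugmentationDatum V q γ) (f : K[X]) :
    expansionMin V q γ f ≤ V (f % q) := by
  simpa only [expansionCoeff, zero_nsmul, add_zero] using
    h.le_expansionMin_iff.1 (le_refl (expansionMin V q γ f)) 0

theorem expansionMin_mul_of_eq_mod (h : IsAugmentationDatum V q γ) {f g : K[X]}
    (hf : expansionMin V q γ f = V (f % q)) (hg : expansionMin V q γ g = V (g % q)) :
    expansionMin V q γ (f * g) = expansionMin V q γ f + expansionMin V q γ g := by
  refine le_antisymm ?_ (h.add_le_expansionMin_mul f g)
  rw [hf, hg, ← h.map_mul_mod _ _ (degree_mod_lt f h.ne_zero) (degree_mod_lt g h.ne_zero),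
    ← mul_mod]
  exact h.expansionMin_le_mod (f * g)

theorem expansionMin_mul_add_eq_mod (h : IsAugmentationDatum V q γ) {f r : K[X]}
    (hr : r.degree < q.degree) (hle : V r ≤ expansionMin V q γ f + γ) :
    expansionMin V q γ (q * f + r) = V ((q * f + r) % q) := by
  rw [mul_add_mod_of_degree_lt f hr, h.expansionMin_mul_add f hr, min_eq_right hle]

theorem expansionMin_mul_of_left_eq_mod (h : IsAugmentationDatum V q γ) {f : K[X]}
    (hf : expansionMin V q γ f = V (f % q)) (g : K[X]) :
    expansionMin V q γ (f * g) = expansionMin V q γ f + expansionMin V q γ g := by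
  induction g using expansion_induction h.natDegree_pos with
  | zero => rw [mul_zero, h.expansionMin_zero, add_top]
  | mul_add g r hr ih =>
    rcases lt_or_ge (expansionMin V q γ g + γ) (V r) with hlt | hle
    · exact h.expansionMin_mul_mul_add_of_lt hr ih hlt
    · exact h.expansionMin_mul_of_eq_mod hf (h.expansionMin_mul_add_eq_mod hr hle)

theorem expansionMin_mul (h : IsAugmentationDatum V q γ) (f g : K[X]) :
    expansionMin V q γ (f * g) = expansionMin V q γ f + expansionMin V q γ g := by
  rw [mul_comm, add_comm]
  induction f using expansion_induction h.natDegree_pos with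
  | zero => rw [mul_zero, h.expansionMin_zero, add_top]
  | mul_add f r hr ih =>
    rcases lt_or_ge (expansionMin V q γ f + γ) (V r) with hlt | hle
    · exact h.expansionMin_mul_mul_add_of_lt hr ih hlt
    · rw [mul_comm, add_comm (expansionMin V q γ g)]
      exact h.expansionMin_mul_of_left_eq_mod (h.expansionMin_mul_add_eq_mod hr hle) g

/-- The augmented valuation `f₀ + f₁ q + ⋯ + f_r q ^ r ↦ min_j (V(f_j) + j γ)`. -/
def valuation (h : IsAugmentationDatum V q γ) : AddValuation K[X] (WithTop Γ) :=
  AddValuation.of (expansionMin V q γ) h.expansionMin_zero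
    ((h.expansionMin_of_degree_lt h.degree_one_lt).trans h.map_one)
    h.min_le_expansionMin_add h.expansionMin_mul

theorem valuation_apply (h : IsAugmentationDatum V q γ) (f : K[X]) :
    h.valuation f = expansionMin V q γ f := rfl

theorem valuation_of_degree_lt (h : IsAugmentationDatum V q γ) {f : K[X]}
    (hf : f.degree < q.degree) : h.valuation f = V f :=
  h.expansionMin_of_degree_lt hf

theorem valuation_self (h : IsAugmentationDatum V q γ) : h.valuation q = γ := by
  calc h.valuation q = expansionMin V q γ (q * 1) := by rw [mul_one, h.valuation_apply]
    _ = V 1 + γ := by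
      rw [h.expansionMin_self_mul, h.expansionMin_of_degree_lt h.degree_one_lt]
    _ = γ := by rw [h.map_one, zero_add]

theorem valuation_eq_truncation (h : IsAugmentationDatum V q γ) (f : K[X]) :
    h.valuation f = truncation h.valuation q f := by
  rw [h.valuation_apply, expansionMin, truncation]
  refine Finset.inf_congr rfl fun j _ => ?_
  rw [AddValuation.map_mul, AddValuation.map_pow, h.valuation_self,
    h.valuation_of_degree_lt (degree_expansionCoeff_lt h.natDegree_pos f j)]

end IsAugmentationDatum

end Augmentation

variable [IsOrderedAddMonoid Γ]

section LimitDatum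

variable {ι : Type*} {l : Filter ι} {ν : ι → AddValuation K[X] (WithTop Γ)}
  {V : K[X] → WithTop Γ} {Q : K[X]} {γ : WithTop Γ}

/-- Along the filter `l`, the valuations `ν i` have the eventual values `V` at the polynomials of
degree less than `deg Q`, while their values at `Q` do not become constant and eventually lie below
`γ`. These are the data of a limit augmentation. -/
structure IsLimitDatum (l : Filter ι) (ν : ι → AddValuation K[X] (WithTop Γ))
    (V : K[X] → WithTop Γ) (Q : K[X]) (γ : WithTop Γ) : Prop where
  natDegree_pos : 0 < Q.natDegree
  eventually_eq : ∀ f : K[X], f.degree < Q.degree → ∀ᶠ i in l, ν i f = V f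
  not_eventuallyConst : ¬ EventuallyConst (fun i => ν i Q) l
  eventually_lt : ∀ᶠ i in l, ν i Q < γ

namespace IsLimitDatum

theorem ne_zero (h : IsLimitDatum l ν V Q γ) : Q ≠ 0 :=
  ne_zero_of_natDegree_gt h.natDegree_pos

theorem neBot (h : IsLimitDatum l ν V Q γ) : l.NeBot :=
  ⟨fun hbot => h.not_eventuallyConst (hbot ▸ .bot)⟩

theorem not_eventually_eq (h : IsLimitDatum l ν V Q γ) (x : WithTop Γ) :
    ¬ ∀ᶠ i in l, ν i Q = x := fun hx =>
  h.not_eventuallyConst (eventuallyConst_iff_exists_eventuallyEq.2 ⟨x, hx⟩)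

theorem eq_top_of_eventually_add_eq (h : IsLimitDatum l ν V Q γ) {b c : WithTop Γ}
    (hbc : ∀ᶠ i in l, ν i Q + c = b) : b = ⊤ := by
  have := h.neBot
  by_contra hb
  obtain ⟨i, hi⟩ := hbc.exists
  have hc : c ≠ ⊤ := by
    rintro rfl
    exact hb (hi.symm.trans (add_top _))
  refine h.not_eventually_eq (ν i Q) ?_
  filter_upwards [hbc] with j hj
  exact WithTop.add_right_cancel hc (hj.trans hi.symm)

theorem eq_of_eventually_mul_add_eq (h : IsLimitDatum l ν V Q γ) {s r : K[X]} {a b c : WithTop Γ}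
    (hs : ∀ᶠ i in l, ν i s = c) (hr : ∀ᶠ i in l, ν i r = b)
    (hsum : ∀ᶠ i in l, ν i (Q * s + r) = a) : b = a := by
  by_contra hne
  have hmin : ∀ᶠ i in l, ν i Q + c = min a b := by
    filter_upwards [hs, hr, hsum] with i hs hr hsum
    have hdiff := (ν i).map_add_of_distinct_val (x := Q * s + r) (y := -r) <| by
      rw [AddValuation.map_neg, hsum, hr]
      exact Ne.symm hne
    rwa [add_neg_cancel_right, AddValuation.map_mul, AddValuation.map_neg, hs, hr, hsum] at hdiff
  have htop := min_eq_top.1 (h.eq_top_of_eventually_add_eq hmin)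
  exact hne (htop.2.trans htop.1.symm)

theorem eventually_map_mul (h : IsLimitDatum l ν V Q γ) {f g : K[X]} (hf : f.degree < Q.degree)
    (hg : g.degree < Q.degree) : ∀ᶠ i in l, ν i (f * g) = V f + V g := by
  filter_upwards [h.eventually_eq f hf, h.eventually_eq g hg] with i hfi hgi
  rw [AddValuation.map_mul, hfi, hgi]

theorem map_mul_mod (h : IsLimitDatum l ν V Q γ) {f g : K[X]} (hf : f.degree < Q.degree)
    (hg : g.degree < Q.degree) : V (f * g % Q) = V f + V g :=
  h.eq_of_eventually_mul_add_eq (h.eventually_eq _ (degree_mul_div_lt hf hg))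
    (h.eventually_eq _ (degree_mod_lt _ h.ne_zero)) <| by
      simpa only [EuclideanDomain.div_add_mod] using h.eventually_map_mul hf hg

theorem le_map_mul_div (h : IsLimitDatum l ν V Q γ) {f g : K[X]} (hf : f.degree < Q.degree)
    (hg : g.degree < Q.degree) : V f + V g ≤ V (f * g / Q) + γ := by
  have := h.neBot
  obtain ⟨i, hfgi, hmodi, hdivi, hlt⟩ := ((h.eventually_map_mul hf hg).and
    ((h.eventually_eq _ (degree_mod_lt (f * g) h.ne_zero)).and
      ((h.eventually_eq _ (degree_mul_div_lt hf hg)).and h.eventually_lt))).exists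
  calc V f + V g ≤ ν i (f * g - f * g % Q) :=
        (ν i).map_le_sub hfgi.ge ((h.map_mul_mod hf hg).symm.trans hmodi.symm).le
    _ = V (f * g / Q) + ν i Q := by
        rw [sub_eq_of_eq_add (EuclideanDomain.div_add_mod (f * g) Q).symm, AddValuation.map_mul,
          hdivi, add_comm]
    _ ≤ V (f * g / Q) + γ := add_le_add_right hlt.le _

theorem isAugmentationDatum (h : IsLimitDatum l ν V Q γ) : IsAugmentationDatum V Q γ := by
  have := h.neBot
  refine ⟨h.natDegree_pos, ?_, ?_, fun f hf => ?_, fun f g hf hg => ?_,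
    fun _ _ => h.map_mul_mod, fun _ _ => h.le_map_mul_div⟩
  · obtain ⟨i, hi⟩ := (h.eventually_eq 0 (degree_zero_lt_degree h.ne_zero)).exists
    exact hi.symm.trans (ν i).map_zero
  · obtain ⟨i, hi⟩ := (h.eventually_eq (C 1) (degree_C_lt_degree h.natDegree_pos 1)).exists
    exact hi.symm.trans (ν i).map_one
  · obtain ⟨i, hi, hi'⟩ := ((h.eventually_eq f hf).and
      (h.eventually_eq (-f) ((degree_neg f).trans_lt hf))).exists
    rw [← hi, ← hi', AddValuation.map_neg]
  · obtain ⟨i, hfi, hgi, hfgi⟩ := ((h.eventually_eq f hf).and ((h.eventually_eq g hg).and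
      (h.eventually_eq (f + g) ((degree_add_le f g).trans_lt (max_lt hf hg))))).exists
    rw [← hfi, ← hgi, ← hfgi]
    exact (ν i).map_add f g

theorem map_mod_lt (h : IsLimitDatum l ν V Q γ) {f : K[X]} (hf : 0 < f.natDegree)
    (hfQ : f.degree < Q.degree) : V (Q % f) < γ := by
  have hf0 : 0 < f.degree := natDegree_pos_iff_degree_pos.1 hf
  have hmod : (Q % f).degree < Q.degree := (degree_mod_lt Q (ne_zero_of_degree_gt hf0)).trans hfQ
  by_contra! hle
  refine h.not_eventually_eq (V f + V (Q / f)) ?_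
  filter_upwards [h.eventually_eq f hfQ, h.eventually_eq _ (degree_div_lt h.ne_zero hf0),
    h.eventually_eq _ hmod, h.eventually_lt] with i hfi hdivi hmodi hlt
  calc ν i Q = ν i (Q - Q % f) :=
        ((ν i).map_sub_eq_of_lt_left (hlt.trans_le (hle.trans_eq hmodi.symm))).symm
    _ = V f + V (Q / f) := by
        rw [sub_eq_of_eq_add (EuclideanDomain.div_add_mod Q f).symm, AddValuation.map_mul, hfi,
          hdivi]

theorem eventually_map_self_lt (h : IsLimitDatum l ν V Q γ)
    (hmono : ∀ i, ∀ᶠ j in l, ∀ f, ν i f ≤ ν j f) (i : ι) :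
    ∀ᶠ j in l, ν i Q < ν j Q := by
  obtain ⟨k, hk⟩ : ∃ k, ν i Q < ν k Q := by
    by_contra! hle
    refine h.not_eventually_eq (ν i Q) ?_
    filter_upwards [hmono i] with j hj
    exact le_antisymm (hle j) (hj Q)
  filter_upwards [hmono k] with j hj
  exact hk.trans_le (hj Q)

theorem eventually_eq_top_of_map_self_mul_eq (h : IsLimitDatum l ν V Q γ)
    (hmono : ∀ i, ∀ᶠ j in l, ∀ f, ν i f ≤ ν j f) (f : K[X])
    (c : WithTop Γ) : ∀ᶠ j in l, ν j (Q * f) = c → ν j f = ⊤ := by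
  by_cases hex : ∃ i, ν i (Q * f) = c ∧ ν i f ≠ ⊤
  · obtain ⟨i, hi, hif⟩ := hex
    filter_upwards [hmono i, h.eventually_map_self_lt hmono i] with j hj hlt heq
    refine absurd (hi.trans heq.symm) (ne_of_lt ?_)
    rw [AddValuation.map_mul, AddValuation.map_mul]
    exact (WithTop.add_lt_add_right hif hlt).trans_le (add_le_add_right (hj f) _)
  · push Not at hex
    exact .of_forall hex

theorem le_expansionMin (h : IsLimitDatum l ν V Q γ)
    (hmono : ∀ i, ∀ᶠ j in l, ∀ f, ν i f ≤ ν j f) (f : K[X]) (i : ι) :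
    ν i f ≤ expansionMin V Q γ f := by
  have := h.neBot
  induction f using expansion_induction h.natDegree_pos generalizing i with
  | zero => rw [h.isAugmentationDatum.expansionMin_zero]; exact le_top
  | mul_add f r hr ih =>
    rw [h.isAugmentationDatum.expansionMin_mul_add f hr]
    obtain ⟨j, hij, hrj, hlt, htop⟩ := ((hmono i).and ((h.eventually_eq r hr).and
      (h.eventually_lt.and (h.eventually_eq_top_of_map_self_mul_eq hmono f (V r))))).exists
    refine (hij _).trans ?_
    rcases eq_or_ne (ν j (Q * f)) (V r) with heq | hne
    · have hfj : ν j f = ⊤ := htop heq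
      rw [AddValuation.map_mul, hfj, add_top] at heq
      rw [← heq, top_unique (hfj.ge.trans (ih j)), top_add, min_self]
      exact le_top
    · rw [AddValuation.map_add_of_distinct_val _ (hrj ▸ hne), AddValuation.map_mul, hrj, add_comm]
      exact min_le_min_right _ (add_le_add (ih j) hlt.le)

end IsLimitDatum

end LimitDatum

section Delta

variable {L : Type*} [Field L] {w : AddValuation L[X] (WithTop Γ)}

theorem map_multiset_prod_eq_sum (w : AddValuation L[X] (WithTop Γ)) (s : Multiset L[X]) :
    w s.prod = (s.map w).sum := by
  induction s using Multiset.induction with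
  | empty => exact w.map_one
  | cons f s ih =>
    rw [Multiset.prod_cons, AddValuation.map_mul, ih, Multiset.map_cons, Multiset.sum_cons]

theorem map_comp_eq_sum_roots (w : AddValuation L[X] (WithTop Γ)) {f : L[X]} (hf : f.Splits)
    (g : L[X]) :
    w (f.comp g) = w (C f.leadingCoeff) + (f.roots.map fun b => w (g - C b)).sum := by
  conv_lhs => rw [hf.eq_prod_roots, mul_comp, C_comp, multiset_prod_comp, AddValuation.map_mul,
    map_multiset_prod_eq_sum, Multiset.map_map, Multiset.map_map]
  simp only [Function.comp_apply, sub_comp, X_comp, C_comp]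

theorem map_X_sub_C_le_delta (w : AddValuation L[X] (WithTop Γ)) {f : L[X]} {a : L}
    (ha : a ∈ f.roots) : (w (X - C a) : WithBot (WithTop Γ)) ≤ delta w f :=
  Multiset.le_sup (Multiset.mem_map_of_mem _ ha)

theorem exists_mem_roots_delta_eq (w : AddValuation L[X] (WithTop Γ)) {f : L[X]}
    (hf : f.roots ≠ 0) : ∃ a ∈ f.roots, delta w f = w (X - C a) := by
  classical
  obtain ⟨a, ha, hmax⟩ := f.roots.toFinset.exists_max_image (fun a => w (X - C a))
    (Multiset.toFinset_nonempty.2 hf)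
  rw [Multiset.mem_toFinset] at ha
  refine ⟨a, ha, le_antisymm (Multiset.sup_le.2 ?_) (map_X_sub_C_le_delta w ha)⟩
  simp only [Multiset.mem_map, forall_exists_index, and_imp, forall_apply_eq_imp_iff₂,
    WithBot.coe_le_coe]
  exact fun b hb => hmax b (Multiset.mem_toFinset.2 hb)

theorem map_le_map_C_eval_of_delta_le {f : L[X]} (hf : f.Splits) {a : L}
    (ha : delta w f ≤ w (X - C a)) : w f ≤ w (C (f.eval a)) := by
  conv_lhs => rw [← comp_X (p := f), map_comp_eq_sum_roots w hf]
  rw [← comp_C, map_comp_eq_sum_roots w hf]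
  have hroot (b : L) (hb : b ∈ f.roots) : w (X - C b) ≤ w (C a - C b) := by
    have hba : w (X - C b) ≤ w (X - C a) :=
      WithBot.coe_le_coe.1 ((map_X_sub_C_le_delta w hb).trans ha)
    simpa only [sub_sub_sub_cancel_left] using w.map_le_sub le_rfl hba
  exact add_le_add_right (Multiset.sum_map_le_sum_map _ _ hroot) _

theorem map_C_eval_eq_map_of_delta_lt {f : L[X]} (hf : f.Splits) {a : L}
    (ha : delta w f < w (X - C a)) : w (C (f.eval a)) = w f := by
  conv_rhs => rw [← comp_X (p := f), map_comp_eq_sum_roots w hf]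
  rw [← comp_C, map_comp_eq_sum_roots w hf]
  have hroot (b : L) (hb : b ∈ f.roots) : w (C a - C b) = w (X - C b) := by
    have hba : w (X - C b) < w (X - C a) :=
      WithBot.coe_lt_coe.1 ((map_X_sub_C_le_delta w hb).trans_lt ha)
    simpa only [sub_sub_sub_cancel_left] using w.map_sub_eq_of_lt_left hba
  rw [Multiset.map_congr rfl hroot]

theorem roots_ne_zero_of_delta_le [IsAlgClosed L] {f g : L[X]} (hf : 0 < f.natDegree)
    (hδ : delta w f ≤ delta w g) : g.roots ≠ 0 := by
  obtain ⟨b, -, hb⟩ := exists_mem_roots_delta_eq w ((IsAlgClosed.splits f).roots_ne_zero hf.ne')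
  intro hg
  rw [hb, delta, hg, Multiset.map_zero, Multiset.sup_zero] at hδ
  exact WithBot.not_coe_le_bot _ hδ

theorem eval_map_mod_eq {φ : K →+* L} (Q : K[X]) {f : K[X]} {a : L} (ha : (f.map φ).IsRoot a) :
    ((Q % f).map φ).eval a = (Q.map φ).eval a := by
  conv_rhs => rw [← EuclideanDomain.div_add_mod Q f, Polynomial.map_add, Polynomial.map_mul,
    eval_add, eval_mul, ha.eq_zero, zero_mul, zero_add]

/-- Replacing `x` by the root of `f` closest to `x` does not lower the value of `Q`; it does not
change the value of `Q % f` either, unless `δ(Q % f) ≥ δ(f)`, and then `Q % f` is a counterexample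
of smaller degree than `f`. -/
theorem degree_le_of_delta_le [IsAlgClosed L] (φ : K →+* L) {Q : K[X]} (hQ : 0 < Q.natDegree)
    (hmod : ∀ f : K[X], 0 < f.natDegree → f.degree < Q.degree →
      w ((Q % f).map φ) < w (Q.map φ))
    {f : K[X]} (hf : f ≠ 0) (hδ : delta w (Q.map φ) ≤ delta w (f.map φ)) :
    Q.degree ≤ f.degree := by
  induction f using WellFounded.induction degree_lt_wf with
  | _ f ih =>
    by_contra! hdeg
    have hroots : (f.map φ).roots ≠ 0 :=
      roots_ne_zero_of_delta_le ((natDegree_map φ).symm ▸ hQ) hδ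
    obtain ⟨a, ha, haδ⟩ := exists_mem_roots_delta_eq w hroots
    have hf_pos : 0 < f.natDegree := by
      contrapose! hroots
      rw [eq_C_of_natDegree_le_zero hroots, map_C, roots_C]
    have hlt := hmod f hf_pos hdeg
    have hle : w (Q.map φ) ≤ w (C (((Q % f).map φ).eval a)) := by
      rw [eval_map_mod_eq Q (isRoot_of_mem_roots ha)]
      exact map_le_map_C_eval_of_delta_le (IsAlgClosed.splits _) (hδ.trans_eq haδ)
    rcases lt_or_ge (delta w ((Q % f).map φ)) (delta w (f.map φ)) with hδ_lt | hδ_ge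
    · rw [map_C_eval_eq_map_of_delta_lt (IsAlgClosed.splits _) (haδ ▸ hδ_lt)] at hle
      exact hle.not_gt hlt
    · have hmod_ne : Q % f ≠ 0 := by
        intro h0
        rw [h0, Polynomial.map_zero, AddValuation.map_zero] at hlt
        exact not_top_lt hlt
      have hmod_deg : (Q % f).degree < f.degree := degree_mod_lt Q hf
      exact (ih _ hmod_deg hmod_ne (hδ.trans hδ_ge)).not_gt (hmod_deg.trans hdeg)

end Delta

section KeyPolynomial

/-- `Q` is a key polynomial for `ν` with respect to all extensions of `ν` to `K̄[x]`, with values in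
any totally ordered group containing `Γ`. Unlike `IsKeyPolynomial`, this is meaningful when `Γ` is
not divisible and `ν` has no extension with values in `Γ ∪ {∞}`. -/
def IsUniversalKeyPolynomial (ν : AddValuation K[X] (WithTop Γ)) (Q : K[X]) : Prop :=
  Q.Monic ∧
    ∀ (Γ' : Type u) [AddCommGroup Γ'] [LinearOrder Γ'] [IsOrderedAddMonoid Γ'] (ι : Γ →+ Γ'),
      StrictMono ι → ∀ w : AddValuation (AlgebraicClosure K)[X] (WithTop Γ'),
        (∀ f : K[X], w (f.map (algebraMap K (AlgebraicClosure K))) = (ν f).map ι) →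
          ∀ f : K[X], f ≠ 0 →
            delta w (Q.map (algebraMap K (AlgebraicClosure K))) ≤
              delta w (f.map (algebraMap K (AlgebraicClosure K))) →
            Q.degree ≤ f.degree

variable {ν : AddValuation K[X] (WithTop Γ)} {Q : K[X]}

theorem IsUniversalKeyPolynomial.isKeyPolynomial (h : IsUniversalKeyPolynomial ν Q) :
    IsKeyPolynomial ν Q :=
  ⟨h.1, fun w hw => h.2 Γ (AddMonoidHom.id Γ) strictMono_id w fun f =>
    (hw f).trans (congrFun WithTop.map_id (ν f)).symm⟩

theorem isUniversalKeyPolynomial_of_map_mod_lt (hQ : Q.Monic) (hQ_pos : 0 < Q.natDegree)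
    (hmod : ∀ f : K[X], 0 < f.natDegree → f.degree < Q.degree → ν (Q % f) < ν Q) :
    IsUniversalKeyPolynomial ν Q := by
  refine ⟨hQ, fun Γ' _ _ _ ι hι w hw f => degree_le_of_delta_le _ hQ_pos fun g hg hgQ => ?_⟩
  rw [hw, hw]
  exact hι.withTop_map (hmod g hg hgQ)

theorem IsLimitDatum.isUniversalKeyPolynomial {ι : Type*} {l : Filter ι}
    {ν : ι → AddValuation K[X] (WithTop Γ)} {V : K[X] → WithTop Γ} {γ : WithTop Γ}
    (h : IsLimitDatum l ν V Q γ) (hQ : Q.Monic) :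
    IsUniversalKeyPolynomial h.isAugmentationDatum.valuation Q := by
  refine isUniversalKeyPolynomial_of_map_mod_lt hQ h.natDegree_pos fun f hf hfQ => ?_
  have hf_ne : f ≠ 0 := ne_zero_of_natDegree_gt hf
  rw [h.isAugmentationDatum.valuation_self,
    h.isAugmentationDatum.valuation_of_degree_lt ((degree_mod_lt Q hf_ne).trans hfQ)]
  exact h.map_mod_lt hf hfQ

end KeyPolynomial

section ValPoset

variable {ν₀ : AddValuation K (WithTop Γ)} {v : Set (ValPoset ν₀)} {f Q : K[X]} {γ : WithTop Γ}

/-- The elements of `v` other than `ν₀`, which index the limits along `v`. -/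
def polyVals (v : Set (ValPoset ν₀)) : Set (PolyVal ν₀) :=
  {ν | (ν : ValPoset ν₀) ∈ v}

theorem isDirectedOrder_polyVals (hv : DirectedOn (· ≤ ·) v) : IsDirectedOrder (polyVals v) := by
  refine DirectedOn.isDirectedOrder fun ν hν ν' hν' => ?_
  obtain ⟨κ, hκ, hνκ, hν'κ⟩ := hv ν hν ν' hν'
  obtain ⟨κ, rfl⟩ := WithBot.ne_bot_iff_exists.1 (ne_bot_of_le_ne_bot WithBot.coe_ne_bot hνκ)
  exact ⟨κ, hκ, WithBot.coe_le_coe.1 hνκ, WithBot.coe_le_coe.1 hν'κ⟩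

theorem IsStable.eventually_eq_stableValue (hf : IsStable v f) :
    ∀ᶠ ν : polyVals v in atTop, ν.1.val f = stableValue v f := by
  rw [stableValue, dif_pos hf]
  obtain ⟨hmem, hconst⟩ := hf.choose_spec
  filter_upwards [eventually_ge_atTop ⟨hf.choose, hmem⟩] with ν hν
  exact hconst ν.1 ν.2 hν

theorem isStable_of_eventuallyConst (hv : DirectedOn (· ≤ ·) v) (hne : (polyVals v).Nonempty)
    (hf : EventuallyConst (fun ν : polyVals v => ν.1.val f) atTop) : IsStable v f := by
  have := isDirectedOrder_polyVals hv
  have := hne.to_subtype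
  obtain ⟨x, hx⟩ := eventuallyConst_iff_exists_eventuallyEq.1 hf
  obtain ⟨ν, hν⟩ := eventually_atTop.1 hx
  exact ⟨ν, ν.2, fun ν' hν' hle => (hν ⟨ν', hν'⟩ hle).trans (hν ν le_rfl).symm⟩

theorem isStable_C (hne : (polyVals v).Nonempty) (a : K) : IsStable v (C a) := by
  obtain ⟨ν, hν⟩ := hne
  exact ⟨ν, hν, fun ν' _ _ => (ν'.val_C a).trans (ν.val_C a).symm⟩

theorem stableValue_C (hv : DirectedOn (· ≤ ·) v) (hne : (polyVals v).Nonempty) (a : K) :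
    stableValue v (C a) = ν₀ a := by
  have := isDirectedOrder_polyVals hv
  have := hne.to_subtype
  obtain ⟨ν, hν⟩ := (isStable_C hne a).eventually_eq_stableValue.exists
  exact hν.symm.trans (ν.1.val_C a)

theorem isLimitDatum_stableValue (hv : DirectedOn (· ≤ ·) v) (hne : (polyVals v).Nonempty)
    (hQ : ¬ IsStable v Q) (hmin : ∀ f : K[X], ¬ IsStable v f → Q.degree ≤ f.degree)
    (hγ : ∀ ν ∈ polyVals v, ν.val Q < γ) :
    IsLimitDatum atTop (fun ν : polyVals v => ν.1.val) (stableValue v) Q γ where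
  natDegree_pos := by
    contrapose! hQ
    rw [eq_C_of_natDegree_le_zero hQ]
    exact isStable_C hne _
  eventually_eq f hf := (of_not_not fun h => (hmin f h).not_gt hf).eventually_eq_stableValue
  not_eventuallyConst hconst := hQ (isStable_of_eventuallyConst hv hne hconst)
  eventually_lt := .of_forall fun ν => hγ ν.1 ν.2

theorem le_limitMap
    (h : IsLimitDatum atTop (fun ν : polyVals v => ν.1.val) (stableValue v) Q γ)
    {ν : PolyVal ν₀} (hν : ν ∈ polyVals v) (f : K[X]) : ν.val f ≤ limitMap v Q γ f :=
  h.le_expansionMin (fun ν => (eventually_ge_atTop ν).mono fun _ hle => hle) f ⟨ν, hν⟩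

theorem polyVals_nonempty (hne : v.Nonempty) (hmax : ∀ ν ∈ v, ∃ ν' ∈ v, ν < ν') :
    (polyVals v).Nonempty := by
  obtain ⟨ν, hν⟩ := hne
  obtain ⟨ν', hν', hlt⟩ := hmax ν hν
  obtain ⟨κ, rfl⟩ := WithBot.ne_bot_iff_exists.1 hlt.ne_bot
  exact ⟨κ, hν'⟩

end ValPoset

end KeyPoly

end

theorem mainTheorem5_general {K : Type*} [Field K]
    {Γ : Type*} [AddCommGroup Γ] [LinearOrder Γ] [IsOrderedAddMonoid Γ]
    (ν₀ : AddValuation K (WithTop Γ)) (v : Set (KeyPoly.ValPoset ν₀))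
    (hne : (KeyPoly.polyVals v).Nonempty) (hv : DirectedOn (· ≤ ·) v)
    (Q : Polynomial K) (hQ : Q.Monic) (hQv : ¬ KeyPoly.IsStable v Q)
    (hmin : ∀ f : Polynomial K, ¬ KeyPoly.IsStable v f → Q.degree ≤ f.degree)
    (γ : WithTop Γ) (hγ : ∀ ν ∈ KeyPoly.polyVals v, ν.val Q < γ) :
    ∃ μ : KeyPoly.PolyVal ν₀,
      (∀ f : Polynomial K, μ.val f = KeyPoly.limitMap v Q γ f) ∧
      (∀ ν ∈ v, ν < (μ : KeyPoly.ValPoset ν₀)) ∧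
      (∀ f : Polynomial K, μ.val f = KeyPoly.truncation μ.val Q f) ∧
      KeyPoly.IsUniversalKeyPolynomial μ.val Q := by
  have hlim := KeyPoly.isLimitDatum_stableValue hv hne hQv hmin hγ
  have haug := hlim.isAugmentationDatum
  have hμ_C (a : K) : haug.valuation (Polynomial.C a) = ν₀ a :=
    (haug.valuation_of_degree_lt (KeyPoly.degree_C_lt_degree haug.natDegree_pos a)).trans
      (KeyPoly.stableValue_C hv hne a)
  have hlt (ν : KeyPoly.PolyVal ν₀) (hν : ν ∈ KeyPoly.polyVals v) : ν < ⟨haug.valuation, hμ_C⟩ := by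
    refine lt_of_le_not_ge (KeyPoly.le_limitMap hlim hν) fun hle => (hγ ν hν).not_ge ?_
    exact haug.valuation_self.ge.trans (hle Q)
  refine ⟨⟨haug.valuation, hμ_C⟩, fun _ => rfl, fun ν hν => ?_, haug.valuation_eq_truncation,
    hlim.isUniversalKeyPolynomial hQ⟩
  cases ν using WithBot.recBotCoe with
  | bot => exact WithBot.bot_lt_coe _
  | coe ν => exact WithBot.coe_lt_coe.2 (hlt ν hν)

theorem mainTheorem5 {K : Type*} [Field K]
    {Γ : Type*} [AddCommGroup Γ] [LinearOrder Γ] [IsOrderedAddMonoid Γ]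
    (hΓ : ∀ n : ℕ, n ≠ 0 → ∀ x : Γ, ∃ y : Γ, n • y = x)
    (ν₀ : AddValuation K (WithTop Γ))
    (v : Set (KeyPoly.ValPoset ν₀)) (hne : v.Nonempty) (hchain : IsChain (· ≤ ·) v)
    (hmax : ∀ ν ∈ v, ∃ ν' ∈ v, ν < ν')
    (Q : Polynomial K) (hQ : Q.Monic) (hQv : ¬ KeyPoly.IsStable v Q)
    (hmin : ∀ f : Polynomial K, ¬ KeyPoly.IsStable v f → Q.degree ≤ f.degree)
    (γ : WithTop Γ)
    (hγ : ∀ ν : KeyPoly.PolyVal ν₀, (ν : KeyPoly.ValPoset ν₀) ∈ v → ν.val Q < γ) :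
    ∃ μ : KeyPoly.PolyVal ν₀,
      (∀ f : Polynomial K, μ.val f = KeyPoly.limitMap v Q γ f) ∧
      (∀ ν ∈ v, ν < (μ : KeyPoly.ValPoset ν₀)) ∧
      (∀ f : Polynomial K, μ.val f = KeyPoly.truncation μ.val Q f) ∧
      KeyPoly.IsKeyPolynomial μ.val Q := by

  obtain ⟨μ, hμ, hlt, htrunc, hkey⟩ := mainTheorem5_general ν₀ v
    (KeyPoly.polyVals_nonempty hne hmax) hchain.directedOn Q hQ hQv hmin γ hγ
  exact ⟨μ, hμ, hlt, htrunc, hkey.isKeyPolynomial⟩
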